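/- Let $M$ be a smooth manifold and $H$ a closed three-form on $M$. Let $\mathbb{T}M=TM\oplus T^*M$ carry the pairing $\langle X+\xi,Y+\nu\rangle=\nu(X)+\xi(Y)$, the Dorfman bracket $[\![X+\xi,Y+\nu]\!]=[X,Y]+L_X\nu-\iota_Yd\xi+\iota_Y\iota_XH$, and the projections $\rho:\mathbb{T}M\to TM$, $\rho_{T^*}:\mathbb{T}M\to T^*M$. Let $L\subset\mathbb{T}M$ be a Dirac structure (a smooth maximally isotropic subbundle, involutive for this bracket), viewed as a Lie algebroid with bracket $[\cdot,\cdot]=[\![\cdot,\cdot]\!]|_{\Gamma(L)}$, and let $\nabla^K$ be a smooth affine connection on $M$ (also denoting the dual connection on $T^*M$). For $a,b\in\Gamma(L)$ put $$\phi^{KL}(a,b)=\rho_{T^*}([a,b])+\nabla^K_{\rho(b)}(\rho_{T^*}a)-\nabla^K_{\rho(a)}(\rho_{T^*}b).$$ A generalized connection on a vector bundle $E\to M$ is a linear operator $D:\Gamma(E)\to\Gamma(\mathbb{T}M\otimes E)$ (with $\mathbb{T}M\cong\mathbb{T}M^*$ through the pairing) such that $D_a(f\sigma)=fD_a\sigma+\rho(a)(f)\,\sigma$.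 Write $D=\nabla+V$, where $\nabla_X=D_{X+0}$ is a connection on $E$ and $V_\xi=D_{0+\xi}$, $V\in\Gamma(TM\otimes\mathrm{End}\,E)$. For $a=X+\xi$, $b=Y+\nu$ the $K$-curvature is $$R^K_D(a,b)=R_\nabla(X,Y)+[V_\xi,V_\nu]+(\nabla_XV)_\nu-(\nabla_YV)_\xi,\qquad (\nabla_XV)_\nu=[\nabla_X,V_\nu]-V_{\nabla^K_X\nu}.$$ If $E=\mathbb{T}M$, the $K$-torsion is $$T^K_D(a,b)=T_\nabla(X,Y)+T_V(\xi,\nu)+T^{(1,1)}(X,\nu)-T^{(1,1)}(Y,\xi),$$ with $T_\nabla(X,Y)=\nabla_XY-\nabla_YX-[X,Y]$, $T_V(\xi,\nu)=V_\xi\nu-V_\nu\xi$ and $T^{(1,1)}(X,\nu)=\nabla_X\nu-\nabla^K_X\nu-V_\nu X$. Then: 1. $\phi^{KL}$ is a tensor, $\phi^{KL}\in\Gamma(\Lambda^2L^*\otimes T^*M)$. 2. For every vector bundle $E\to M$ and every generalized connection $D=\nabla+V$ on $E$, the $K$-curvature restricts to the curvature of the Lie algebroid connection $D|_L$ of $L$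 on $E$, that is, $R^K_D(a,b)=[D_a,D_b]-D_{[a,b]}$ for all $a,b\in\Gamma(L)$, if and only if $\langle V,\phi^{KL}\rangle=0$, that is, $V_{\phi^{KL}(a,b)}=0$ for all $a,b\in\Gamma(L)$. 3. For every generalized connection $D$ on $E=\mathbb{T}M$ that preserves $L$ (that is, $D_ab\in\Gamma(L)$ for all $a,b\in\Gamma(L)$), the $K$-torsion restricts to the Lie algebroid torsion of $D|_L$, that is, $T^K_D(a,b)=D_ab-D_ba-[a,b]$ for all $a,b\in\Gamma(L)$, if and only if $\phi^{KL}=0$. -/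

import Mathlib

open Bundle
open scoped Manifold ContDiff Topology

noncomputable section

namespace KCourant

section Bundles

variable (n : ℕ) (M : Type*) [TopologicalSpace M] [ChartedSpace (EuclideanSpace ℝ (Fin n)) M]

/-- Model fibre of `TM`. -/
abbrev TanModel : Type := EuclideanSpace ℝ (Fin n)

/-- Model fibre of `T*M`. -/
abbrev CotModel : Type := EuclideanSpace ℝ (Fin n) →L[ℝ] ℝ

/-- Model fibre of `TM ⊕ T*M`. -/
abbrev GenModel : Type := EuclideanSpace ℝ (Fin n) × (EuclideanSpace ℝ (Fin n) →L[ℝ] ℝ)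

/-- The tangent bundle `TM` of an `n`-manifold. -/
abbrev Tan : M → Type := fun x ↦ TangentSpace (𝓡 n) x

/-- The cotangent bundle `T*M`. -/
abbrev Cot : M → Type := fun x ↦ TangentSpace (𝓡 n) x →L[ℝ] ℝ

/-- The generalized tangent bundle `𝕋M = TM ⊕ T*M`. -/
abbrev Gen : M → Type := fun x ↦ TangentSpace (𝓡 n) x × (TangentSpace (𝓡 n) x →L[ℝ] ℝ)

/-- Smooth vector fields. -/
abbrev VField [IsManifold (𝓡 n) ∞ M] : Type _ := Cₛ^∞⟮𝓡 n; TanModel n, Tan n M⟯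

/-- Smooth one-forms. -/
abbrev OneForm [IsManifold (𝓡 n) ∞ M] : Type _ := Cₛ^∞⟮𝓡 n; CotModel n, Cot n M⟯

/-- Smooth sections of `𝕋M`. -/
abbrev GenSection [IsManifold (𝓡 n) ∞ M] : Type _ := Cₛ^∞⟮𝓡 n; GenModel n, Gen n M⟯

/-- An affine connection: a (not yet smooth) covariant derivative on `TM`. -/
abbrev AffineConnection [IsManifold (𝓡 n) ∞ M] : Type _ :=
  CovariantDerivative (𝓡 n) (TanModel n) (Tan n M)

end Bundles

section Components

variable {n : ℕ} {M : Type*} [TopologicalSpace M] [ChartedSpace (EuclideanSpace ℝ (Fin n)) M]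
  [IsManifold (𝓡 n) ∞ M]

theorem contMDiff_gen_iff {a : ∀ x : M, Gen n M x} :
    ContMDiff (𝓡 n) ((𝓡 n).prod 𝓘(ℝ, GenModel n)) ∞
        (fun x ↦ TotalSpace.mk' (GenModel n) (E := Gen n M) x (a x)) ↔
      ContMDiff (𝓡 n) ((𝓡 n).prod 𝓘(ℝ, TanModel n)) ∞
          (fun x ↦ TotalSpace.mk' (TanModel n) (E := Tan n M) x (a x).1) ∧
        ContMDiff (𝓡 n) ((𝓡 n).prod 𝓘(ℝ, CotModel n)) ∞
          (fun x ↦ TotalSpace.mk' (CotModel n) (E := Cot n M) x (a x).2) := by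
  constructor
  · intro h
    exact ⟨fun x ↦ (contMDiffAt_section x).2
        ((contDiff_fst (𝕜 := ℝ) (n := ∞) (E := TanModel n) (F := CotModel n)).contMDiff.contMDiffAt.comp
          x ((contMDiffAt_section x).1 (h x))),
      fun x ↦ (contMDiffAt_section x).2
        ((contDiff_snd (𝕜 := ℝ) (n := ∞) (E := TanModel n) (F := CotModel n)).contMDiff.contMDiffAt.comp
          x ((contMDiffAt_section x).1 (h x)))⟩
  · rintro ⟨h₁, h₂⟩ x
    exact (contMDiffAt_section x).2
      (((contMDiffAt_section x).1 (h₁ x)).prodMk_space ((contMDiffAt_section x).1 (h₂ x)))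

/-- The anchor `ρ : Γ(𝕋M) → Γ(TM)`, `X + ξ ↦ X`. -/
def anchor (a : GenSection n M) : VField n M := ⟨fun x ↦ (a x).1, (contMDiff_gen_iff.1 a.contMDiff).1⟩

/-- The projection `ρ_{T*} : Γ(𝕋M) → Γ(T*M)`, `X + ξ ↦ ξ`. -/
def coanchor (a : GenSection n M) : OneForm n M :=
  ⟨fun x ↦ (a x).2, (contMDiff_gen_iff.1 a.contMDiff).2⟩

/-- The section `X + ξ` of `𝕋M`. -/
def mkGen (X : VField n M) (ξ : OneForm n M) : GenSection n M :=
  ⟨fun x ↦ (X x, ξ x), contMDiff_gen_iff.2 ⟨X.contMDiff, ξ.contMDiff⟩⟩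

/-- The symmetric pairing `⟨X + ξ, Y + ν⟩ = ν(X) + ξ(Y)` on `𝕋ₓM`. -/
def pairing {x : M} (u v : Gen n M x) : ℝ := v.2 u.1 + u.2 v.1

/-- Differentiability at `x` of a vector field. -/
abbrev DiffAt (Z : ∀ x : M, Tan n M x) (x : M) : Prop :=
  MDifferentiableAt (𝓡 n) ((𝓡 n).prod 𝓘(ℝ, TanModel n))
    (fun y ↦ TotalSpace.mk' (TanModel n) (E := Tan n M) y (Z y)) x

theorem mdiffAt_pair (η : OneForm n M) {Z : ∀ x : M, Tan n M x} {x : M} (hZ : DiffAt Z x) :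
    MDifferentiableAt (𝓡 n) 𝓘(ℝ, ℝ) (fun y ↦ η y (Z y)) x := by
  have h := MDifferentiableAt.clm_bundle_apply (F₁ := TanModel n) (E₁ := Tan n M) (F₂ := ℝ)
    (E₂ := Bundle.Trivial M ℝ) (b := fun y : M ↦ y) (ϕ := fun y ↦ η y) (v := Z)
    (η.mdifferentiableAt (x := x)) hZ
  exact (mdifferentiableAt_section (𝓡 n) (E := Bundle.Trivial M ℝ) (fun y ↦ η y (Z y))).1 h

/-- The Lie bracket of vector fields, at a point. -/
abbrev lieBr (X Y : ∀ x : M, Tan n M x) (x : M) : Tan n M x := VectorField.mlieBracket (𝓡 n) X Y x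

/-- The derivative `X(f)` at `x` of a function `f` along a vector field `X`. -/
abbrev dirDeriv (X : ∀ x : M, Tan n M x) (f : M → ℝ) (x : M) : ℝ := mvfderiv (𝓡 n) f x (X x)

theorem lieDeriv_tensorial (X : VField n M) (η : OneForm n M) (x : M) :
    TensorialAt (𝓡 n) (TanModel n)
      (fun Z : ∀ x : M, Tan n M x ↦ dirDeriv X (fun y ↦ η y (Z y)) x - η x (lieBr X Z x)) x where
  smul {f Z} hf hZ := by
    have h1 := mvfderiv_fun_mul hf (mdiffAt_pair η hZ)
    have h2 := VectorField.mlieBracket_smul_right (I := 𝓡 n) (V := X) hf hZ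
    simp only [dirDeriv, lieBr, Pi.smul_apply', map_smul, smul_eq_mul]
    rw [h1, h2]
    simp
    ring
  add {Z Z'} hZ hZ' := by
    have h1 := mvfderiv_fun_add (mdiffAt_pair η hZ) (mdiffAt_pair η hZ')
    have h2 := VectorField.mlieBracket_add_right (I := 𝓡 n) (V := X) hZ hZ'
    simp only [dirDeriv, lieBr, Pi.add_apply, map_add]
    rw [h1, h2]
    simp
    ring

/-- The Lie derivative `L_X η` of a one-form: the one-form with
`(L_X η)(Z) = X(η(Z)) - η([X, Z])` for every vector field `Z`. -/
def lieDeriv (X : VField n M) (η : OneForm n M) (x : M) : Cot n M x :=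
  TensorialAt.mkHom _ x (lieDeriv_tensorial X η x)

theorem lieDeriv_apply (X : VField n M) (η : OneForm n M) {x : M} {Z : ∀ x : M, Tan n M x}
    (hZ : DiffAt Z x) :
    lieDeriv X η x (Z x) = dirDeriv X (fun y ↦ η y (Z y)) x - η x (lieBr X Z x) :=
  TensorialAt.mkHom_apply (lieDeriv_tensorial X η x) hZ

theorem contractExtDeriv_tensorial (Y : VField n M) (ξ : OneForm n M) (x : M) :
    TensorialAt (𝓡 n) (TanModel n)
      (fun Z : ∀ x : M, Tan n M x ↦ dirDeriv Y (fun y ↦ ξ y (Z y)) x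
        - dirDeriv Z (fun y ↦ ξ y (Y y)) x - ξ x (lieBr Y Z x)) x where
  smul {f Z} hf hZ := by
    have h := (lieDeriv_tensorial Y ξ x).smul hf hZ
    rw [sub_right_comm, h]
    simp [dirDeriv]
    ring
  add {Z Z'} hZ hZ' := by
    have h := (lieDeriv_tensorial Y ξ x).add hZ hZ'
    rw [sub_right_comm, h]
    simp [dirDeriv]
    ring

/-- The contraction `ι_Y dξ`: the one-form with
`dξ(Y, Z) = Y(ξ(Z)) - Z(ξ(Y)) - ξ([Y, Z])` for every vector field `Z`. -/
def contractExtDeriv (Y : VField n M) (ξ : OneForm n M) (x : M) : Cot n M x :=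
  TensorialAt.mkHom _ x (contractExtDeriv_tensorial Y ξ x)

theorem contractExtDeriv_apply (Y : VField n M) (ξ : OneForm n M) {x : M} {Z : ∀ x : M, Tan n M x}
    (hZ : DiffAt Z x) :
    contractExtDeriv Y ξ x (Z x) = dirDeriv Y (fun y ↦ ξ y (Z y)) x
      - dirDeriv Z (fun y ↦ ξ y (Y y)) x - ξ x (lieBr Y Z x) :=
  TensorialAt.mkHom_apply (contractExtDeriv_tensorial Y ξ x) hZ

theorem dualConn_tensorial (K : AffineConnection n M) (X : VField n M) (η : OneForm n M) (x : M) :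
    TensorialAt (𝓡 n) (TanModel n)
      (fun Z : ∀ x : M, Tan n M x ↦ dirDeriv X (fun y ↦ η y (Z y)) x - η x (K Z x (X x))) x where
  smul {f Z} hf hZ := by
    have h1 := mvfderiv_fun_mul hf (mdiffAt_pair η hZ)
    have h2 := K.isCovariantDerivativeOn.leibniz hZ hf
    simp only [dirDeriv, Pi.smul_apply', map_smul, smul_eq_mul]
    rw [h1, h2]
    simp
    ring
  add {Z Z'} hZ hZ' := by
    have h1 := mvfderiv_fun_add (mdiffAt_pair η hZ) (mdiffAt_pair η hZ')
    have h2 := K.isCovariantDerivativeOn.add hZ hZ'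
    simp only [dirDeriv, Pi.add_apply, map_add]
    rw [h1, h2]
    simp
    ring

/-- The covariant derivative `∇ᴷ_X η` of a one-form along an affine connection: the one-form with
`(∇ᴷ_X η)(Z) = X(η(Z)) - η(∇ᴷ_X Z)` for every vector field `Z`. -/
def dualConn (K : AffineConnection n M) (X : VField n M) (η : OneForm n M) (x : M) : Cot n M x :=
  TensorialAt.mkHom _ x (dualConn_tensorial K X η x)

theorem dualConn_apply (K : AffineConnection n M) (X : VField n M) (η : OneForm n M) {x : M}
    {Z : ∀ x : M, Tan n M x} (hZ : DiffAt Z x) :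
    dualConn K X η x (Z x) = dirDeriv X (fun y ↦ η y (Z y)) x - η x (K Z x (X x)) :=
  TensorialAt.mkHom_apply (dualConn_tensorial K X η x) hZ

end Components

section Courant

variable (n : ℕ) (M : Type*) [TopologicalSpace M] [ChartedSpace (EuclideanSpace ℝ (Fin n)) M]
  [IsManifold (𝓡 n) ∞ M]

/-- A smooth closed three-form `H`: an alternating trilinear form on each tangent space, smooth on
smooth vector fields, with `dH = 0` (the exterior derivative being expanded by the
invariant formula). -/
structure ClosedThreeForm where
  toFun : ∀ x : M, Tan n M x →L[ℝ] Tan n M x →L[ℝ] Tan n M x →L[ℝ] ℝ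
  alt₁₂ : ∀ x u v, toFun x u u v = 0
  alt₂₃ : ∀ x u v, toFun x u v v = 0
  smooth : ∀ X Y Z : VField n M,
    ContMDiff (𝓡 n) 𝓘(ℝ, ℝ) ∞ (fun x ↦ toFun x (X x) (Y x) (Z x))
  closed : ∀ (W X Y Z : VField n M) (x : M),
    dirDeriv W (fun y ↦ toFun y (X y) (Y y) (Z y)) x
      - dirDeriv X (fun y ↦ toFun y (W y) (Y y) (Z y)) x
      + dirDeriv Y (fun y ↦ toFun y (W y) (X y) (Z y)) x
      - dirDeriv Z (fun y ↦ toFun y (W y) (X y) (Y y)) x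
      - toFun x (lieBr W X x) (Y x) (Z x) + toFun x (lieBr W Y x) (X x) (Z x)
      - toFun x (lieBr W Z x) (X x) (Y x) - toFun x (lieBr X Y x) (W x) (Z x)
      + toFun x (lieBr X Z x) (W x) (Y x) - toFun x (lieBr Y Z x) (W x) (X x) = 0

variable {n M}

/-- The `H`-twisted Dorfman bracket
`[[X + ξ, Y + ν]] = [X, Y] + L_X ν - ι_Y dξ + ι_Y ι_X H`, at a point. -/
def dorfman (H : ClosedThreeForm n M) (a b : GenSection n M) (x : M) : Gen n M x :=
  (lieBr (anchor a) (anchor b) x,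
    lieDeriv (anchor a) (coanchor b) x - contractExtDeriv (anchor b) (coanchor a) x
      + H.toFun x (a x).1 (b x).1)

/-- Isotropy of a subspace of `𝕋ₓM`. -/
def IsIsotropic {x : M} (W : Submodule ℝ (Gen n M x)) : Prop :=
  ∀ u ∈ W, ∀ v ∈ W, pairing u v = 0

/-- A Dirac structure: a smooth subbundle `L` of `𝕋M` (locally spanned by a smooth frame) that is
maximally isotropic and involutive for the Dorfman bracket. -/
structure DiracStructure (H : ClosedThreeForm n M) where
  fiber : ∀ x : M, Submodule ℝ (Gen n M x)
  exists_frame : ∀ x₀ : M, ∃ (r : ℕ) (s : Fin r → ∀ x : M, Gen n M x) (U : Set M),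
    IsOpen U ∧ x₀ ∈ U ∧
    (∀ i, ContMDiffOn (𝓡 n) ((𝓡 n).prod 𝓘(ℝ, GenModel n)) ∞
      (fun x ↦ TotalSpace.mk' (GenModel n) (E := Gen n M) x (s i x)) U) ∧
    ∀ x ∈ U, LinearIndependent ℝ (fun i ↦ s i x) ∧
      Submodule.span ℝ (Set.range fun i ↦ s i x) = fiber x
  isotropic : ∀ x, IsIsotropic (fiber x)
  maximal : ∀ x (W : Submodule ℝ (Gen n M x)), IsIsotropic W → fiber x ≤ W → W = fiber x
  involutive : ∀ a b : GenSection n M, (∀ x, a x ∈ fiber x) → (∀ x, b x ∈ fiber x) →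
    ∀ x, dorfman H a b x ∈ fiber x

/-- The sections `Γ(L)` of a Dirac structure, as the smooth sections of `𝕋M` with values in `L`. -/
def DiracStructure.IsSection {H : ClosedThreeForm n M} (L : DiracStructure H)
    (a : GenSection n M) : Prop := ∀ x, a x ∈ L.fiber x

/-- The tensor `φᴷᴸ` on sections `a, b` of a Dirac structure, with values in `T*M`:
`φᴷᴸ(a, b) = ρ_{T*}[a, b] + ∇ᴷ_{ρ(b)} (ρ_{T*} a) - ∇ᴷ_{ρ(a)} (ρ_{T*} b)`. -/
def phi (H : ClosedThreeForm n M) (K : AffineConnection n M) (a b : GenSection n M) (x : M) :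
    Cot n M x :=
  (dorfman H a b x).2 + dualConn K (anchor b) (coanchor a) x
    - dualConn K (anchor a) (coanchor b) x

end Courant

section GeneralizedConnections

variable {n : ℕ} {M : Type*} [TopologicalSpace M] [ChartedSpace (EuclideanSpace ℝ (Fin n)) M]
  [IsManifold (𝓡 n) ∞ M]

/-- A generalized connection on a vector bundle `E → M`: a linear operator
`D : Γ(E) → Γ(𝕋M ⊗ E)`, written as `a ↦ D_a` (that is, with values in `Hom(𝕋M, E)`), with
`D_a(fσ) = f D_a σ + ρ(a)(f) σ`. -/
structure GeneralizedConnection (n : ℕ) (M : Type*) [TopologicalSpace M]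
    [ChartedSpace (EuclideanSpace ℝ (Fin n)) M] [IsManifold (𝓡 n) ∞ M]
    (F : Type*) [NormedAddCommGroup F] [NormedSpace ℝ F]
    (E : M → Type*) [TopologicalSpace (TotalSpace F E)]
    [∀ x, AddCommGroup (E x)] [∀ x, Module ℝ (E x)] [∀ x, TopologicalSpace (E x)]
    [∀ x, IsTopologicalAddGroup (E x)] [∀ x, ContinuousSMul ℝ (E x)]
    [FiberBundle F E] [VectorBundle ℝ F E] where
  toLin : Cₛ^∞⟮𝓡 n; F, E⟯ →ₗ[ℝ] Cₛ^∞⟮𝓡 n; GenModel n →L[ℝ] F, fun x : M ↦ Gen n M x →L[ℝ] E x⟯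
  leibniz : ∀ (f : M → ℝ) (σ τ : Cₛ^∞⟮𝓡 n; F, E⟯), ContMDiff (𝓡 n) 𝓘(ℝ, ℝ) ∞ f →
    (∀ x, τ x = f x • σ x) → ∀ (x : M) (u : Gen n M x),
      toLin τ x u = f x • toLin σ x u + (mvfderiv (𝓡 n) f x u.1) • σ x

variable {F : Type*} [NormedAddCommGroup F] [NormedSpace ℝ F]
  {E : M → Type*} [TopologicalSpace (TotalSpace F E)]
  [∀ x, AddCommGroup (E x)] [∀ x, Module ℝ (E x)] [∀ x, TopologicalSpace (E x)]
  [∀ x, IsTopologicalAddGroup (E x)] [∀ x, ContinuousSMul ℝ (E x)]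
  [FiberBundle F E] [VectorBundle ℝ F E]

namespace GeneralizedConnection

/-- `D_a σ ∈ Γ(E)` for `a ∈ Γ(𝕋M)` and `σ ∈ Γ(E)`. -/
def act (D : GeneralizedConnection n M F E) (a : GenSection n M) (σ : Cₛ^∞⟮𝓡 n; F, E⟯) :
    Cₛ^∞⟮𝓡 n; F, E⟯ :=
  ⟨fun x ↦ D.toLin σ x (a x), (D.toLin σ).contMDiff.clm_bundle_apply a.contMDiff⟩

/-- The ordinary connection `∇` in `D = ∇ + V`: `∇_X σ = D_{X + 0} σ`. -/
def nabla (D : GeneralizedConnection n M F E) (X : VField n M) (σ : Cₛ^∞⟮𝓡 n; F, E⟯) :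
    Cₛ^∞⟮𝓡 n; F, E⟯ := D.act (mkGen X 0) σ

/-- The tensor `V ∈ Γ(TM ⊗ End E)` in `D = ∇ + V`: `V_ξ σ = D_{0 + ξ} σ`. -/
def tensorV (D : GeneralizedConnection n M F E) (ξ : OneForm n M) (σ : Cₛ^∞⟮𝓡 n; F, E⟯) :
    Cₛ^∞⟮𝓡 n; F, E⟯ := D.act (mkGen 0 ξ) σ

/-- `D = ∇ + V`. -/
theorem act_eq (D : GeneralizedConnection n M F E) (a : GenSection n M) (σ : Cₛ^∞⟮𝓡 n; F, E⟯) :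
    D.act a σ = D.nabla (anchor a) σ + D.tensorV (coanchor a) σ := by
  ext x
  change D.toLin σ x (a x) = D.toLin σ x ((a x).1, 0) + D.toLin σ x (0, (a x).2)
  rw [← map_add]
  simp

/-- `V` is tensorial: `V_ξ (f σ) = f V_ξ σ`. -/
theorem tensorV_smul (D : GeneralizedConnection n M F E) (ξ : OneForm n M) (f : M → ℝ)
    (hf : ContMDiff (𝓡 n) 𝓘(ℝ, ℝ) ∞ f) (σ τ : Cₛ^∞⟮𝓡 n; F, E⟯) (h : ∀ x, τ x = f x • σ x) (x : M) :
    D.tensorV ξ τ x = f x • D.tensorV ξ σ x := by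
  change D.toLin τ x (0, ξ x) = f x • D.toLin σ x (0, ξ x)
  simpa using D.leibniz f σ τ hf h x (0, ξ x)

/-- The curvature of the ordinary connection `∇`:
`R_∇(X, Y) σ = ∇_X ∇_Y σ - ∇_Y ∇_X σ - ∇_{[X, Y]} σ`. -/
def curvNabla (D : GeneralizedConnection n M F E) (X Y : VField n M) (σ : Cₛ^∞⟮𝓡 n; F, E⟯) (x : M) :
    E x :=
  D.nabla X (D.nabla Y σ) x - D.nabla Y (D.nabla X σ) x - D.toLin σ x (lieBr X Y x, 0)

/-- The term `V ∧ V`: `(V ∧ V)(ξ, ν) = [V_ξ, V_ν]`. -/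
def wedgeV (D : GeneralizedConnection n M F E) (ξ ν : OneForm n M) (σ : Cₛ^∞⟮𝓡 n; F, E⟯) (x : M) :
    E x :=
  D.tensorV ξ (D.tensorV ν σ) x - D.tensorV ν (D.tensorV ξ σ) x

/-- The covariant derivative of `V` for the connection on `TM ⊗ End E` induced by `∇ᴷ` and `∇`:
`(∇_X V)_ν σ = ∇_X (V_ν σ) - V_ν (∇_X σ) - V_{∇ᴷ_X ν} σ`. -/
def covDerivV (D : GeneralizedConnection n M F E) (K : AffineConnection n M) (X : VField n M)
    (ν : OneForm n M) (σ : Cₛ^∞⟮𝓡 n; F, E⟯) (x : M) : E x :=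
  D.nabla X (D.tensorV ν σ) x - D.tensorV ν (D.nabla X σ) x - D.toLin σ x (0, dualConn K X ν x)

/-- The `K`-curvature `R^K_D = R_∇ + V ∧ V + ∇(V)`, as a two-form on `𝕋M`: on `a = X + ξ` and
`b = Y + ν` it is `R_∇(X, Y) + (V ∧ V)(ξ, ν) + (∇_X V)_ν - (∇_Y V)_ξ`. -/
def kCurvature (D : GeneralizedConnection n M F E) (K : AffineConnection n M) (a b : GenSection n M)
    (σ : Cₛ^∞⟮𝓡 n; F, E⟯) (x : M) : E x :=
  D.curvNabla (anchor a) (anchor b) σ x + D.wedgeV (coanchor a) (coanchor b) σ x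
    + (D.covDerivV K (anchor a) (coanchor b) σ x - D.covDerivV K (anchor b) (coanchor a) σ x)

/-- For sections `a, b` of a Dirac structure `L`, the curvature of the Lie algebroid connection
`D|_L` of `L` on `E`: `F(a, b) σ = D_a D_b σ - D_b D_a σ - D_{[a, b]} σ`. -/
def algebroidCurvature (D : GeneralizedConnection n M F E) (H : ClosedThreeForm n M)
    (a b : GenSection n M) (σ : Cₛ^∞⟮𝓡 n; F, E⟯) (x : M) : E x :=
  D.act a (D.act b σ) x - D.act b (D.act a σ) x - D.toLin σ x (dorfman H a b x)

/-- The `K`-curvature restricts to the curvature of `D|_L`. -/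
def KCurvatureRestricts (D : GeneralizedConnection n M F E) (K : AffineConnection n M)
    {H : ClosedThreeForm n M} (L : DiracStructure H) : Prop :=
  ∀ a b : GenSection n M, L.IsSection a → L.IsSection b → ∀ (σ : Cₛ^∞⟮𝓡 n; F, E⟯) (x : M),
    D.kCurvature K a b σ x = D.algebroidCurvature H a b σ x

/-- The condition `⟨V, φᴷᴸ⟩ = 0`: `V_{φᴷᴸ(a, b)} = 0` for all `a, b ∈ Γ(L)`. -/
def PairingVanishes (D : GeneralizedConnection n M F E) (K : AffineConnection n M)
    {H : ClosedThreeForm n M} (L : DiracStructure H) : Prop :=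
  ∀ a b : GenSection n M, L.IsSection a → L.IsSection b → ∀ (σ : Cₛ^∞⟮𝓡 n; F, E⟯) (x : M),
    D.toLin σ x (0, phi H K a b x) = 0

/-! Torsion of a generalized connection on `𝕋M`. -/

/-- `D` preserves `L`: `D_a b ∈ Γ(L)` for all `a, b ∈ Γ(L)`. -/
def Preserves (D : GeneralizedConnection n M (GenModel n) (Gen n M)) {H : ClosedThreeForm n M}
    (L : DiracStructure H) : Prop :=
  ∀ a b : GenSection n M, L.IsSection a → L.IsSection b → L.IsSection (D.act a b)

/-- `T_∇(X, Y) = ∇_X Y - ∇_Y X - [X, Y]`, with values in `𝕋M`. -/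
def torsionNabla (D : GeneralizedConnection n M (GenModel n) (Gen n M)) (X Y : VField n M) (x : M) :
    Gen n M x :=
  D.nabla X (mkGen Y 0) x - D.nabla Y (mkGen X 0) x - (lieBr X Y x, 0)

/-- `T_V(ν, μ) = V_ν μ - V_μ ν`. -/
def torsionV (D : GeneralizedConnection n M (GenModel n) (Gen n M)) (ν μ : OneForm n M) (x : M) :
    Gen n M x :=
  D.tensorV ν (mkGen 0 μ) x - D.tensorV μ (mkGen 0 ν) x

/-- The mixed term `T(X, ν) = ∇_X ν - ∇ᴷ_X ν - V_ν X`. -/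
def torsionMixed (D : GeneralizedConnection n M (GenModel n) (Gen n M)) (K : AffineConnection n M)
    (X : VField n M) (ν : OneForm n M) (x : M) : Gen n M x :=
  D.nabla X (mkGen 0 ν) x - (0, dualConn K X ν x) - D.tensorV ν (mkGen X 0) x

/-- The `K`-torsion `T^K_D`, the sum of the three terms above as a two-form on `𝕋M` with values
in `𝕋M`: on `a = X + ξ` and `b = Y + ν` it is
`T_∇(X, Y) + T_V(ξ, ν) + (T(X, ν) - T(Y, ξ))`. -/
def kTorsion (D : GeneralizedConnection n M (GenModel n) (Gen n M)) (K : AffineConnection n M)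
    (a b : GenSection n M) (x : M) : Gen n M x :=
  D.torsionNabla (anchor a) (anchor b) x + D.torsionV (coanchor a) (coanchor b) x
    + (D.torsionMixed K (anchor a) (coanchor b) x - D.torsionMixed K (anchor b) (coanchor a) x)

/-- For sections `a, b` of a Dirac structure preserved by `D`, the Lie algebroid torsion of
`D|_L`: `D_a b - D_b a - [a, b]`. -/
def algebroidTorsion (D : GeneralizedConnection n M (GenModel n) (Gen n M))
    (H : ClosedThreeForm n M) (a b : GenSection n M) (x : M) : Gen n M x :=
  D.act a b x - D.act b a x - dorfman H a b x

/-- The `K`-torsion restricts to the torsion of `D|_L`. -/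
def KTorsionRestricts (D : GeneralizedConnection n M (GenModel n) (Gen n M))
    (K : AffineConnection n M) {H : ClosedThreeForm n M} (L : DiracStructure H) : Prop :=
  ∀ a b : GenSection n M, L.IsSection a → L.IsSection b →
    ∀ x, D.kTorsion K a b x = D.algebroidTorsion H a b x

end GeneralizedConnection

end GeneralizedConnections

/-- `φᴷᴸ` is a section of `Λ²L* ⊗ T*M`: on `Γ(L)` it is skew-symmetric, additive and
`C^∞(M)`-linear, and its contraction with smooth vector fields is smooth. -/
structure PhiIsTensor {n : ℕ} {M : Type*} [TopologicalSpace M]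
    [ChartedSpace (EuclideanSpace ℝ (Fin n)) M] [IsManifold (𝓡 n) ∞ M]
    (K : AffineConnection n M) {H : ClosedThreeForm n M} (L : DiracStructure H) : Prop where
  skew : ∀ a b : GenSection n M, L.IsSection a → L.IsSection b →
    ∀ x, phi H K a b x = - phi H K b a x
  add : ∀ a b c : GenSection n M, L.IsSection a → L.IsSection b → L.IsSection c →
    ∀ x, phi H K a (b + c) x = phi H K a b x + phi H K a c x
  smul : ∀ (f : M → ℝ) (a b c : GenSection n M), ContMDiff (𝓡 n) 𝓘(ℝ, ℝ) ∞ f →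
    L.IsSection a → L.IsSection b → (∀ x, c x = f x • b x) →
    ∀ x, phi H K a c x = f x • phi H K a b x
  smooth : ∀ (a b : GenSection n M) (Z : VField n M), L.IsSection a → L.IsSection b →
    ContMDiff (𝓡 n) 𝓘(ℝ, ℝ) ∞ (fun x ↦ phi H K a b x (Z x))

end KCourant

end

open KCourant

/-! Write a = X + ξ and b = Y + ν. In φ(a, b)(Z) the derivatives X(ν(Z)) and Y(ξ(Z)), coming from
`lieDeriv` and `contractExtDeriv`, cancel against those in the dual connection. `phi_apply` records
what is left: ν(∇ᴷ_X Z - [X, Z]) - ξ(∇ᴷ_Y Z - [Y, Z]) + Z(ξ(Y)) + H(X, Y, Z). Part 1 is read off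
from this formula. Linearity in b holds on all of 𝕋M, while skew-symmetry fails exactly by d⟨a, b⟩,
which vanishes on the isotropic `L`. Parts 2 and 3 are defect identities valid for all sections of
𝕋M: the `K`-curvature minus the algebroid curvature is V_φ (`kCurvature_eq`), and the `K`-torsion
minus the algebroid torsion is 0 + φ (`kTorsion_eq`). In both, the `K`-version uses ∇ᴷ_X ν - ∇ᴷ_Y ξ
where the algebroid version uses the cotangent part of [a, b], and φ is the difference of the two.
Each equivalence then says that a defect vanishes on `L`. -/

namespace KCourant

/-! ### Tensoriality and smoothness of φ -/

section PhiTensor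

variable {n : ℕ} {M : Type*} [TopologicalSpace M] [ChartedSpace (EuclideanSpace ℝ (Fin n)) M]
  [IsManifold (𝓡 n) ∞ M]

/-- `φᴷᴸ(a, b)` on a vector field, written without second-order cancellations. -/
theorem phi_apply (H : ClosedThreeForm n M) (K : AffineConnection n M) (a b : GenSection n M)
    {x : M} {Z : ∀ x : M, Tan n M x} (hZ : DiffAt Z x) :
    phi H K a b x (Z x) =
      coanchor b x (K Z x (anchor a x)) - coanchor b x (lieBr (anchor a) Z x)
        - (coanchor a x (K Z x (anchor b x)) - coanchor a x (lieBr (anchor b) Z x))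
        + dirDeriv Z (fun y ↦ coanchor a y (anchor b y)) x
        + H.toFun x (anchor a x) (anchor b x) (Z x) := by
  have h1 := lieDeriv_apply (anchor a) (coanchor b) hZ
  have h2 := contractExtDeriv_apply (anchor b) (coanchor a) hZ
  have h3 := dualConn_apply K (anchor b) (coanchor a) hZ
  have h4 := dualConn_apply K (anchor a) (coanchor b) hZ
  change lieDeriv (anchor a) (coanchor b) x (Z x) - contractExtDeriv (anchor b) (coanchor a) x (Z x)
    + H.toFun x (anchor a x) (anchor b x) (Z x) + dualConn K (anchor b) (coanchor a) x (Z x)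
    - dualConn K (anchor a) (coanchor b) x (Z x) = _
  rw [h1, h2, h3, h4]
  ring

/-- Two covectors agree once they agree on all differentiable vector fields. -/
theorem cot_ext {x : M} {α β : Cot n M x}
    (h : ∀ Z : ∀ x : M, Tan n M x, DiffAt Z x → α (Z x) = β (Z x)) : α = β := by
  ext v
  simpa using h (FiberBundle.extend (TanModel n) v)
    (FiberBundle.mdifferentiableAt_extend (𝓡 n) (TanModel n) v)

theorem mdiffAt_contract (ξ : OneForm n M) (Y : VField n M) (x : M) :
    MDifferentiableAt (𝓡 n) 𝓘(ℝ, ℝ) (fun y ↦ ξ y (Y y)) x :=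
  mdiffAt_pair ξ Y.mdifferentiableAt

/-- Polarization of `alt₁₂` at u + v. -/
theorem ClosedThreeForm.swap (H : ClosedThreeForm n M) (x : M) (u v w : Tan n M x) :
    H.toFun x u v w = - H.toFun x v u w := by
  have h := H.alt₁₂ x (u + v) w
  have h1 : H.toFun x (u + v) (u + v) w
      = H.toFun x u u w + H.toFun x u v w + (H.toFun x v u w + H.toFun x v v w) := by
    rw [(H.toFun x).map_add u v, add_apply, add_apply, (H.toFun x u).map_add u v,
      (H.toFun x v).map_add u v, add_apply, add_apply]
  rw [h1, H.alt₁₂, H.alt₁₂] at h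
  linarith

/-- In `phi_apply` everything is visibly skew except Z(ξ(Y)), whose symmetric part is Z⟨a, b⟩. -/
theorem phi_skew (H : ClosedThreeForm n M) (K : AffineConnection n M) (a b : GenSection n M)
    (hab : ∀ x, pairing (a x) (b x) = 0) (x : M) : phi H K a b x = - phi H K b a x := by
  refine cot_ext fun Z hZ ↦ ?_
  have h : (fun y ↦ coanchor a y (anchor b y)) = fun y ↦ - coanchor b y (anchor a y) :=
    funext fun y ↦ by
      have := hab y
      simp only [pairing] at this
      change (a y).2 (b y).1 = - (b y).2 (a y).1
      linarith
  have h' : dirDeriv Z (fun y ↦ coanchor a y (anchor b y)) x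
      = - dirDeriv Z (fun y ↦ coanchor b y (anchor a y)) x := by
    rw [h]
    have := mvfderiv_neg (I := 𝓡 n) (g := fun y ↦ coanchor b y (anchor a y)) (x := x)
    exact congrArg (fun l ↦ l (Z x)) this
  rw [neg_apply, phi_apply H K a b hZ, phi_apply H K b a hZ, h', H.swap]
  ring

theorem phi_add (H : ClosedThreeForm n M) (K : AffineConnection n M) (a b c : GenSection n M)
    (x : M) : phi H K a (b + c) x = phi H K a b x + phi H K a c x := by
  refine cot_ext fun Z hZ ↦ ?_
  have h1 : lieBr (anchor (b + c)) Z x = lieBr (anchor b) Z x + lieBr (anchor c) Z x :=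
    VectorField.mlieBracket_add_left (I := 𝓡 n) (W := Z)
      (anchor b).mdifferentiableAt (anchor c).mdifferentiableAt
  have h2 : dirDeriv Z (fun y ↦ coanchor a y (anchor (b + c) y)) x
      = dirDeriv Z (fun y ↦ coanchor a y (anchor b y)) x
        + dirDeriv Z (fun y ↦ coanchor a y (anchor c y)) x := by
    have h : (fun y ↦ coanchor a y (anchor (b + c) y))
        = fun y ↦ coanchor a y (anchor b y) + coanchor a y (anchor c y) :=
      funext fun y ↦ map_add (coanchor a y) (anchor b y) (anchor c y)
    rw [h]
    exact congrArg (fun l ↦ l (Z x)) (mvfderiv_fun_add (mdiffAt_contract (coanchor a) (anchor b) x)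
      (mdiffAt_contract (coanchor a) (anchor c) x))
  have h3 : anchor (b + c) x = anchor b x + anchor c x := rfl
  have h4 : coanchor (b + c) x = coanchor b x + coanchor c x := rfl
  rw [add_apply, phi_apply H K a _ hZ, phi_apply H K a b hZ, phi_apply H K a c hZ, h1, h2, h3, h4]
  simp only [map_add, add_apply]
  ring

/-- Only two terms of `phi_apply` differentiate f when b becomes f b: ξ([f Y, Z]) contributes -Z(f)
ξ(Y), and Z(f ξ(Y)) contributes +Z(f) ξ(Y). They cancel without any isotropy. -/
theorem phi_smul (H : ClosedThreeForm n M) (K : AffineConnection n M) {f : M → ℝ}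
    (hf : ContMDiff (𝓡 n) 𝓘(ℝ, ℝ) ∞ f) (a b c : GenSection n M) (hc : ∀ x, c x = f x • b x)
    (x : M) : phi H K a c x = f x • phi H K a b x := by
  refine cot_ext fun Z hZ ↦ ?_
  have hfx : MDifferentiableAt (𝓡 n) 𝓘(ℝ, ℝ) f x := hf.mdifferentiableAt (by simp)
  have h3 : ∀ y, anchor c y = f y • anchor b y := fun y ↦ congrArg Prod.fst (hc y)
  have h4 : ∀ y, coanchor c y = f y • coanchor b y := fun y ↦ congrArg Prod.snd (hc y)
  have h1 : lieBr (anchor c) Z x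
      = - mvfderiv (𝓡 n) f x (Z x) • anchor b x + f x • lieBr (anchor b) Z x := by
    have h : ⇑(anchor c) = f • ⇑(anchor b) := funext h3
    rw [lieBr, h]
    exact VectorField.mlieBracket_smul_left (I := 𝓡 n) (W := Z) hfx (anchor b).mdifferentiableAt
  have h2 : dirDeriv Z (fun y ↦ coanchor a y (anchor c y)) x
      = f x * dirDeriv Z (fun y ↦ coanchor a y (anchor b y)) x
        + mvfderiv (𝓡 n) f x (Z x) * coanchor a x (anchor b x) := by
    have h : (fun y ↦ coanchor a y (anchor c y)) = fun y ↦ f y * coanchor a y (anchor b y) :=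
      funext fun y ↦ by rw [h3, map_smul, smul_eq_mul]
    rw [h, dirDeriv, mvfderiv_fun_mul hfx (mdiffAt_contract (coanchor a) (anchor b) x)]
    simp [mul_comm]
  rw [smul_apply, phi_apply H K a c hZ, phi_apply H K a b hZ, h1, h2, h3, h4]
  simp only [map_add, map_smul, smul_apply, smul_eq_mul]
  ring

/-! ### Smoothness of the terms of φ -/

theorem contMDiff_pair (ξ : OneForm n M) {Z : ∀ x : M, Tan n M x}
    (hZ : ContMDiff (𝓡 n) ((𝓡 n).prod 𝓘(ℝ, TanModel n)) ∞
      (fun y ↦ TotalSpace.mk' (TanModel n) (E := Tan n M) y (Z y))) :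
    ContMDiff (𝓡 n) 𝓘(ℝ, ℝ) ∞ (fun y ↦ ξ y (Z y)) := by
  have h := ContMDiff.clm_bundle_apply (F₁ := TanModel n) (E₁ := Tan n M) (F₂ := ℝ)
    (E₂ := Bundle.Trivial M ℝ) (b := fun y : M ↦ y) (ϕ := fun y ↦ ξ y) (v := Z)
    ξ.contMDiff hZ
  exact fun x ↦ (contMDiffAt_section (E := Bundle.Trivial M ℝ) x).1 (h x)

/-- Z(f) is the fibre component of the tangent map of f composed with Z, and the tangent bundle of ℝ
is trivial. -/
theorem contMDiff_dirDeriv (Z : VField n M) {f : M → ℝ} (hf : ContMDiff (𝓡 n) 𝓘(ℝ, ℝ) ∞ f) :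
    ContMDiff (𝓡 n) 𝓘(ℝ, ℝ) ∞ (dirDeriv Z f) :=
  (contMDiff_snd_tangentBundle_modelSpace ℝ 𝓘(ℝ, ℝ)).comp
    ((hf.contMDiff_tangentMap le_rfl).comp Z.contMDiff)

theorem contMDiff_lieBr (X Z : VField n M) :
    ContMDiff (𝓡 n) ((𝓡 n).prod 𝓘(ℝ, TanModel n)) ∞
      (fun y ↦ TotalSpace.mk' (TanModel n) (E := Tan n M) y (lieBr X Z y)) :=
  -- The bracket costs one derivative, but ∞ + 1 is ∞ by definition, so the given instance serves.
  haveI : IsManifold (𝓡 n) (((⊤ : ℕ∞) : ℕ∞ω) + 1) M := ‹IsManifold (𝓡 n) ∞ M›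
  haveI : IsManifold (𝓡 n) (minSmoothness ℝ 2) M := by
    rw [minSmoothness_of_isRCLikeNormedField]
    infer_instance
  ContDiff.mlieBracket_vectorField (m := ⊤) (n := ⊤) X.contMDiff Z.contMDiff (by simp)

theorem contMDiff_cov {K : AffineConnection n M} (hK : K.ContMDiffCovariantDerivative ∞)
    (X Z : VField n M) :
    ContMDiff (𝓡 n) ((𝓡 n).prod 𝓘(ℝ, TanModel n)) ∞
      (fun y ↦ TotalSpace.mk' (TanModel n) (E := Tan n M) y (K Z y (X y))) := by
  have h := contMDiffOn_univ.1 (hK.contMDiff.contMDiff (σ := Z) Z.contMDiff.contMDiffOn)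
  exact h.clm_bundle_apply X.contMDiff

/-- The covectors in `phi` are built pointwise by `TensorialAt.mkHom` and carry no smoothness of
their own; after `phi_apply` only visibly smooth terms remain. -/
theorem contMDiff_phi_apply (H : ClosedThreeForm n M) {K : AffineConnection n M}
    (hK : K.ContMDiffCovariantDerivative ∞) (a b : GenSection n M) (Z : VField n M) :
    ContMDiff (𝓡 n) 𝓘(ℝ, ℝ) ∞ (fun x ↦ phi H K a b x (Z x)) := by
  rw [funext fun x ↦ phi_apply H K a b (x := x) Z.mdifferentiableAt]
  exact (((((contMDiff_pair _ (contMDiff_cov hK _ _)).sub (contMDiff_pair _ (contMDiff_lieBr _ _))).sub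
    ((contMDiff_pair _ (contMDiff_cov hK _ _)).sub (contMDiff_pair _ (contMDiff_lieBr _ _)))).add
    (contMDiff_dirDeriv Z (contMDiff_pair _ (anchor b).contMDiff))).add (H.smooth _ _ _))

/-- Linearity is checked in the second slot; skew-symmetry on `L` transfers it to the first. -/
theorem phiIsTensor {H : ClosedThreeForm n M} (L : DiracStructure H) {K : AffineConnection n M}
    (hK : K.ContMDiffCovariantDerivative ∞) : PhiIsTensor K L where
  skew a b ha hb := phi_skew H K a b fun x ↦ L.isotropic x _ (ha x) _ (hb x)
  add a b c _ _ _ := phi_add H K a b c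
  smul _ a b c hf _ _ hc := phi_smul H K hf a b c hc
  smooth a b Z _ _ := contMDiff_phi_apply H hK a b Z

end PhiTensor

namespace GeneralizedConnection

variable {n : ℕ} {M : Type*} [TopologicalSpace M] [ChartedSpace (EuclideanSpace ℝ (Fin n)) M]
  [IsManifold (𝓡 n) ∞ M]

/-! ### Curvature defect -/

section Curvature

variable {F : Type*} [NormedAddCommGroup F] [NormedSpace ℝ F]
  {E : M → Type*} [TopologicalSpace (TotalSpace F E)]
  [∀ x, AddCommGroup (E x)] [∀ x, Module ℝ (E x)] [∀ x, TopologicalSpace (E x)]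
  [∀ x, IsTopologicalAddGroup (E x)] [∀ x, ContinuousSMul ℝ (E x)]
  [FiberBundle F E] [VectorBundle ℝ F E]

theorem act_add_apply (D : GeneralizedConnection n M F E) (a : GenSection n M)
    (σ τ : Cₛ^∞⟮𝓡 n; F, E⟯) (x : M) : D.act a (σ + τ) x = D.act a σ x + D.act a τ x := by
  change D.toLin (σ + τ) x (a x) = D.toLin σ x (a x) + D.toLin τ x (a x)
  rw [map_add]
  rfl

theorem act_act (D : GeneralizedConnection n M F E) (a b : GenSection n M)
    (σ : Cₛ^∞⟮𝓡 n; F, E⟯) (x : M) :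
    D.act a (D.act b σ) x =
      (D.nabla (anchor a) (D.nabla (anchor b) σ) x + D.tensorV (coanchor a) (D.nabla (anchor b) σ) x)
      + (D.nabla (anchor a) (D.tensorV (coanchor b) σ) x
        + D.tensorV (coanchor a) (D.tensorV (coanchor b) σ) x) := by
  rw [D.act_eq b σ, act_add_apply, D.act_eq a, D.act_eq a]
  rfl

theorem toLin_prod (D : GeneralizedConnection n M F E) (σ : Cₛ^∞⟮𝓡 n; F, E⟯) {x : M}
    (u : Tan n M x) (α : Cot n M x) :
    D.toLin σ x (u, α) = D.toLin σ x (u, 0) + D.toLin σ x (0, α) := by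
  rw [← map_add]
  simp

theorem toLin_phi (D : GeneralizedConnection n M F E) (H : ClosedThreeForm n M)
    (K : AffineConnection n M) (a b : GenSection n M) (σ : Cₛ^∞⟮𝓡 n; F, E⟯) (x : M) :
    D.toLin σ x (0, phi H K a b x) = D.toLin σ x (0, (dorfman H a b x).2)
      + D.toLin σ x (0, dualConn K (anchor b) (coanchor a) x)
      - D.toLin σ x (0, dualConn K (anchor a) (coanchor b) x) := by
  rw [← map_add, ← map_sub]
  simp [phi]

/-- The bookkeeping of `kCurvature_eq` in a bare abelian group. The letters stand for: p the
products ∇∇, q the products VV, r the products ∇V, s the products V∇, t₁ = V_{∇ᴷ_X ν}, t₂ = V_{∇ᴷ_Y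
ξ}, v = ∇_{[X, Y]}, and u = V at the cotangent part of [a, b]. Index 1 marks a-operators acting
after b-operators in p, q, r, s. -/
theorem curvature_sum_eq {G : Type*} [AddCommGroup G]
    {p₁ p₂ q₁ q₂ r₁ r₂ s₁ s₂ t₁ t₂ u v w₁ w₂ w₃ w₄ : G}
    (h₁ : w₁ = (p₁ + s₁) + (r₁ + q₁)) (h₂ : w₂ = (p₂ + s₂) + (r₂ + q₂)) (h₃ : w₃ = v + u)
    (h₄ : w₄ = u + t₂ - t₁) :
    (p₁ - p₂ - v) + (q₁ - q₂) + ((r₁ - s₂ - t₁) - (r₂ - s₁ - t₂)) = w₁ - w₂ - w₃ + w₄ := by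
  subst h₁ h₂ h₃ h₄
  abel

/-- The defect of the `K`-curvature from the algebroid curvature is `⟨V, φᴷᴸ⟩`. -/
theorem kCurvature_eq (D : GeneralizedConnection n M F E) (H : ClosedThreeForm n M)
    (K : AffineConnection n M) (a b : GenSection n M) (σ : Cₛ^∞⟮𝓡 n; F, E⟯) (x : M) :
    D.kCurvature K a b σ x
      = D.algebroidCurvature H a b σ x + D.toLin σ x (0, phi H K a b x) := by
  have h₁ := D.act_act a b σ x
  have h₂ := D.act_act b a σ x
  have h₃ : D.toLin σ x (dorfman H a b x) = D.toLin σ x (lieBr (anchor a) (anchor b) x, 0)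
      + D.toLin σ x (0, (dorfman H a b x).2) := D.toLin_prod σ _ _
  have h₄ := D.toLin_phi H K a b σ x
  unfold kCurvature algebroidCurvature curvNabla wedgeV covDerivV
  exact curvature_sum_eq h₁ h₂ h₃ h₄

theorem kCurvatureRestricts_iff (D : GeneralizedConnection n M F E) (K : AffineConnection n M)
    {H : ClosedThreeForm n M} (L : DiracStructure H) :
    D.KCurvatureRestricts K L ↔ D.PairingVanishes K L := by
  simp only [KCurvatureRestricts, PairingVanishes, D.kCurvature_eq H K, add_eq_left]

end Curvature

/-! ### Torsion defect -/

/-- For torsion the differentiated section must be split as well as the direction; the four pieces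
are those entering T_∇, T_V and the mixed terms. -/
theorem act_eq_of_gen (D : GeneralizedConnection n M (GenModel n) (Gen n M)) (a b : GenSection n M)
    (x : M) :
    D.act a b x = (D.nabla (anchor a) (mkGen (anchor b) 0) x
        + D.tensorV (coanchor a) (mkGen (anchor b) 0) x)
      + (D.nabla (anchor a) (mkGen 0 (coanchor b)) x
        + D.tensorV (coanchor a) (mkGen 0 (coanchor b)) x) := by
  have h : b = mkGen (anchor b) 0 + mkGen 0 (coanchor b) := by
    ext1 x
    exact Prod.ext (add_zero (b x).1).symm (zero_add (b x).2).symm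
  conv_lhs => rw [h]
  rw [act_add_apply, D.act_eq a, D.act_eq a]
  rfl

/-- The defect of the `K`-torsion from the algebroid torsion is `φᴷᴸ`. -/
theorem kTorsion_eq (D : GeneralizedConnection n M (GenModel n) (Gen n M))
    (H : ClosedThreeForm n M) (K : AffineConnection n M) (a b : GenSection n M) (x : M) :
    D.kTorsion K a b x = D.algebroidTorsion H a b x + (0, phi H K a b x) := by
  -- Subtracting [X, Y] + 0 leaves the cotangent part of the Dorfman bracket, so the defect lies in
  -- T*M.
  have h : ((0, phi H K a b x) : Gen n M x) = dorfman H a b x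
      - (lieBr (anchor a) (anchor b) x, 0) + (0, dualConn K (anchor b) (coanchor a) x)
      - (0, dualConn K (anchor a) (coanchor b) x) := by
    refine Prod.ext ?_ ?_
    · simp [dorfman]
    · simp [phi]
  rw [kTorsion, algebroidTorsion, torsionNabla, torsionV, torsionMixed, torsionMixed,
    act_eq_of_gen, act_eq_of_gen, h]
  abel

theorem kTorsionRestricts_iff (D : GeneralizedConnection n M (GenModel n) (Gen n M))
    (K : AffineConnection n M) {H : ClosedThreeForm n M} (L : DiracStructure H) :
    D.KTorsionRestricts K L ↔
      ∀ a b : GenSection n M, L.IsSection a → L.IsSection b → ∀ x, phi H K a b x = 0 := by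
  simp only [KTorsionRestricts, D.kTorsion_eq H K, add_eq_left, Prod.mk_eq_zero, true_and]

end GeneralizedConnection

end KCourant

theorem mainTheorem2 {n : ℕ} {M : Type*} [TopologicalSpace M] [T2Space M]
    [SecondCountableTopology M] [ChartedSpace (EuclideanSpace ℝ (Fin n)) M] [IsManifold (𝓡 n) ∞ M]
    (H : ClosedThreeForm n M) (L : DiracStructure H)
    (K : AffineConnection n M) (hK : K.ContMDiffCovariantDerivative ∞) :
    PhiIsTensor K L ∧
    (∀ {F : Type*} [NormedAddCommGroup F] [NormedSpace ℝ F] [FiniteDimensional ℝ F]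
        {E : M → Type*} [TopologicalSpace (TotalSpace F E)]
        [∀ x, AddCommGroup (E x)] [∀ x, Module ℝ (E x)] [∀ x, TopologicalSpace (E x)]
        [∀ x, IsTopologicalAddGroup (E x)] [∀ x, ContinuousSMul ℝ (E x)]
        [FiberBundle F E] [VectorBundle ℝ F E] [ContMDiffVectorBundle ∞ F E (𝓡 n)]
        (D : GeneralizedConnection n M F E),
      D.KCurvatureRestricts K L ↔ D.PairingVanishes K L) ∧
    (∀ D : GeneralizedConnection n M (GenModel n) (Gen n M), D.Preserves L →
      (D.KTorsionRestricts K L ↔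
        ∀ a b : GenSection n M, L.IsSection a → L.IsSection b → ∀ x, phi H K a b x = 0)) :=
  ⟨phiIsTensor L hK, fun D ↦ D.kCurvatureRestricts_iff K L,
    fun D _ ↦ D.kTorsionRestricts_iff K L⟩
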